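/- Let $(X,\mathcal B,\mu)$ be a probability space and $m$ a positive integer. Let $S$ assign to each $x\in X$ a subset $S(x)\subseteq X$ with $1\le |S(x)|\le m$, and suppose that $S$ is measurable: for all $B\in\mathcal B$ and $k,l\in\mathbb N$ the set $\{x: |S(x)|=k,\ |S(x)\cap B|=l\}$ belongs to $\mathcal B$. For $B\subseteq X$ write $S^{-1}(B)=\{x\in X: S(x)\cap B\ne\emptyset\}$. Suppose that $S$ preserves $\mu$, i.e. $$\int_X \frac{|S(x)\cap B|}{|S(x)|}\,d\mu(x)=\mu(B)\qquad\text{for all } B\in\mathcal B,$$ and that $S$ is ergodic, i.e. $S$ is nonsingular ($\mu(S^{-1}(B))=0$ whenever $B\in\mathcal B$ and $\mu(B)=0$), and every $B\in\mathcal B$ with $B\subseteq S^{-1}(B)$ and $B^c\subseteq S^{-1}(B^c)$ satisfies $\mu(B)=0$ or $\mu(B^c)=0$. Suppose moreover that $\mu(\{x\in X:|S(x)|\ge 2\})>0$. An orbit of $x$ is a sequence $x_0=x,x_1,x_2,\dots$ with $x_{n+1}\in S(x_n)$ for all $n\ge 0$. Then for every $B\in\mathcal B$ with $\mu(B)>0$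 and for $\mu$-almost every $x\in X$, there are uncountably many orbits $(x_n)_{n\ge0}$ of $x$ such that $x_n\in B$ for infinitely many $n$. -/

import Mathlib

open Set Filter MeasureTheory
open scoped ENNReal

namespace MTransformation

variable {X : Type*}

/-- A multivalued transformation `S` of `X`, given as `S : X → Set X`, is an `m`-transformation if
`1 ≤ |S(x)| ≤ m` for every `x`. (`encard` is the cardinality in `ℕ∞`, so `S x` is finite.) -/
def IsMTransformation (m : ℕ) (S : X → Set X) : Prop :=
  ∀ x, 1 ≤ (S x).encard ∧ (S x).encard ≤ m

/-- `S⁻¹_{k;l}(B) = {x : |S(x)| = k, |S(x) ∩ B| = l}`. -/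
def preimageCard (S : X → Set X) (k l : ℕ) (B : Set X) : Set X :=
  {x | (S x).encard = k ∧ (S x ∩ B).encard = l}

/-- The full preimage `S⁻¹(B) = {x : S(x) ∩ B ≠ ∅}`. -/
def fullPreimage (S : X → Set X) (B : Set X) : Set X :=
  {x | (S x ∩ B).Nonempty}

/-- `S` is a measurable `m`-transformation: all the sets `S⁻¹_{k;l}(B)`, for measurable `B`, are
measurable. -/
structure IsMeasurable [MeasurableSpace X] (m : ℕ) (S : X → Set X) : Prop where
  isMTransformation : IsMTransformation m S
  measurableSet_preimageCard :
    ∀ (k l : ℕ) (B : Set X), MeasurableSet B → MeasurableSet (preimageCard S k l B)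

/-- `K(x, B) = |S(x)|⁻¹ ∑_{y ∈ S(x)} χ_B(y)`. -/
noncomputable def kernel (S : X → Set X) (x : X) (B : Set X) : ℝ≥0∞ :=
  ((S x).encard : ℝ≥0∞)⁻¹ * ∑' y : S x, B.indicator 1 (y : X)

/-- `Sμ(B) = ∫ K(x, B) dμ(x)`. -/
noncomputable def pushforward [MeasurableSpace X] (S : X → Set X) (μ : Measure X) (B : Set X) :
    ℝ≥0∞ :=
  ∫⁻ x, kernel S x B ∂μ

/-- The measurable `m`-transformation `S` preserves `μ`: `Sμ = μ` on the σ-algebra. -/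
structure IsMeasurePreserving [MeasurableSpace X] (m : ℕ) (S : X → Set X) (μ : Measure X) :
    Prop where
  isMeasurable : IsMeasurable m S
  pushforward_eq : ∀ B : Set X, MeasurableSet B → pushforward S μ B = μ B

/-- The measurable `m`-transformation `S` is nonsingular: full preimages of null sets are null. -/
structure IsNonsingular [MeasurableSpace X] (m : ℕ) (S : X → Set X) (μ : Measure X) : Prop where
  isMeasurable : IsMeasurable m S
  fullPreimage_null :
    ∀ B : Set X, MeasurableSet B → μ B = 0 → μ (fullPreimage S B) = 0

/-- The nonsingular `m`-transformation `S` is ergodic: a measurable set `B` such that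
`B \ S⁻¹(B) = ∅` and `Bᶜ \ S⁻¹(Bᶜ) = ∅` is null or has null complement. -/
structure IsErgodic [MeasurableSpace X] (m : ℕ) (S : X → Set X) (μ : Measure X) : Prop where
  isNonsingular : IsNonsingular m S μ
  null_or_null_compl :
    ∀ B : Set X, MeasurableSet B → B \ fullPreimage S B = ∅ → Bᶜ \ fullPreimage S Bᶜ = ∅ →
      μ B = 0 ∨ μ Bᶜ = 0

/-- An orbit of `x` is a sequence `x₀ = x, x₁, x₂, …` with `xₙ₊₁ ∈ S(xₙ)` for all `n ≥ 0`. -/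
def IsOrbit (S : X → Set X) (x : X) (o : ℕ → X) : Prop :=
  o 0 = x ∧ ∀ n, o (n + 1) ∈ S (o n)

/-- The sequence `o` returns to `B` infinitely often. -/
def ReturnsInfinitelyOften (o : ℕ → X) (B : Set X) : Prop :=
  {n : ℕ | o n ∈ B}.Infinite

end MTransformation

namespace MTransformation

variable {X : Type*}

/-! Let R be the set of points that can reach a given set of positive measure. Then S⁻¹(R) ⊆ R, and
invariance gives μ(R) ≤ μ(S⁻¹(R)), so the two agree up to a null set; ergodicity makes R conull
(`IsErgodic.measure_compl_eventualPreimage`). Apply this to B and to the set of branching points. By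
nonsingularity, almost every point lies in a forward closed set G all of whose points can reach
both. From a point of G a diagonal argument (`not_countable_orbits`) defeats any enumeration of
orbits: steer alternately to a branching point, to differ from the next listed sequence, and to B.
-/

/-- The points from which some finite path of `S` (possibly of length `0`) leads into `B`. -/
def eventualPreimage (S : X → Set X) (B : Set X) : Set X :=
  ⋃ n : ℕ, (fullPreimage S)^[n] B

section Combinatorics

variable {S : X → Set X} {B : Set X}

theorem subset_eventualPreimage : B ⊆ eventualPreimage S B :=
  fun _ hx => mem_iUnion.2 ⟨0, hx⟩

theorem fullPreimage_mono {C : Set X} (h : B ⊆ C) : fullPreimage S B ⊆ fullPreimage S C :=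
  fun _ hx => hx.mono (inter_subset_inter_right _ h)

theorem fullPreimage_eventualPreimage_subset :
    fullPreimage S (eventualPreimage S B) ⊆ eventualPreimage S B := by
  rintro x ⟨y, hyS, hy⟩
  obtain ⟨n, hn⟩ := mem_iUnion.1 hy
  refine mem_iUnion.2 ⟨n + 1, ?_⟩
  rw [Function.iterate_succ_apply']
  exact ⟨y, hyS, hn⟩

theorem eventualPreimage_subset_union :
    eventualPreimage S B ⊆ B ∪ fullPreimage S (eventualPreimage S B) := by
  intro x hx
  obtain ⟨n, hn⟩ := mem_iUnion.1 hx
  cases n with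
  | zero => exact Or.inl hn
  | succ n =>
    rw [Function.iterate_succ_apply'] at hn
    exact Or.inr (fullPreimage_mono (subset_iUnion _ n) hn)

theorem exists_reflTransGen_of_mem_eventualPreimage {x : X} (hx : x ∈ eventualPreimage S B) :
    ∃ y ∈ B, Relation.ReflTransGen (fun a b => b ∈ S a) x y := by
  obtain ⟨n, hn⟩ := mem_iUnion.1 hx
  induction n generalizing x with
  | zero => exact ⟨x, hn, .refl⟩
  | succ n ih =>
    rw [Function.iterate_succ_apply'] at hn
    obtain ⟨y, hyS, hy⟩ := hn
    obtain ⟨z, hz, hyz⟩ := ih (mem_iUnion.2 ⟨n, hy⟩) hy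
    exact ⟨z, hz, .head hyS hyz⟩

/-- A path of length `n`, followed by arbitrary terms. -/
def IsPath (S : X → Set X) (n : ℕ) (f : ℕ → X) : Prop :=
  ∀ i < n, f (i + 1) ∈ S (f i)

theorem IsPath.exists_extend_one {n : ℕ} {f : ℕ → X} (hf : IsPath S n f) {y : X}
    (hy : y ∈ S (f n)) :
    ∃ g, IsPath S (n + 1) g ∧ (∀ i ≤ n, g i = f i) ∧ g (n + 1) = y := by
  have key : ∀ i ≤ n, Function.update f (n + 1) y i = f i := fun i hi =>
    Function.update_of_ne (by omega) _ _
  refine ⟨Function.update f (n + 1) y, fun i hi => ?_, key, Function.update_self _ _ _⟩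
  rw [key i (by omega)]
  rcases (Nat.lt_succ_iff.1 hi).lt_or_eq with h | rfl
  · rw [key (i + 1) h]
    exact hf i h
  · rwa [Function.update_self]

theorem IsPath.exists_extend {n : ℕ} {f : ℕ → X} (hf : IsPath S n f) {y : X}
    (hy : Relation.ReflTransGen (fun a b => b ∈ S a) (f n) y) :
    ∃ k g, n ≤ k ∧ IsPath S k g ∧ (∀ i ≤ n, g i = f i) ∧ g k = y := by
  induction hy with
  | refl => exact ⟨n, f, le_rfl, hf, fun _ _ => rfl, rfl⟩
  | tail _ hbc ih =>
    obtain ⟨k, g, hnk, hg, hgf, rfl⟩ := ih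
    obtain ⟨h, hh, hhg, hhc⟩ := hg.exists_extend_one hbc
    exact ⟨k + 1, h, by omega, hh, fun i hi => (hhg i (by omega)).trans (hgf i hi), hhc⟩

/-- If every point of a forward closed set `G` leads to a branching point and to `B`, then each
point of `G` has uncountably many orbits returning to `B` infinitely often. -/
theorem not_countable_orbits {G : Set X} (hG : ∀ x ∈ G, S x ⊆ G)
    (hbranch : ∀ x ∈ G, x ∈ eventualPreimage S {y | 2 ≤ (S y).encard})
    (hreach : ∀ x ∈ G, x ∈ eventualPreimage S B) {x : X} (hx : x ∈ G) :
    ¬ {o : ℕ → X | IsOrbit S x o ∧ ReturnsInfinitelyOften o B}.Countable := by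
  intro hcount
  have : Nonempty (ℕ → X) := ⟨fun _ => x⟩
  obtain ⟨e, he⟩ := countable_iff_exists_subset_range.1 hcount
  have hG' : ∀ a b, Relation.ReflTransGen (fun a b => b ∈ S a) a b → a ∈ G → b ∈ G := by
    intro a b hab ha
    induction hab with
    | refl => exact ha
    | tail _ hbc ih => exact hG _ ih hbc
  -- Finite paths from x ending in G; only the terms up to the length p.1 matter.
  let T := {p : ℕ × (ℕ → X) // IsPath S p.1 p.2 ∧ p.2 0 = x ∧ p.2 p.1 ∈ G}
  have step : ∀ (k : ℕ) (p : T), ∃ q : T, p.1.1 < q.1.1 ∧ (∀ i ≤ p.1.1, q.1.2 i = p.1.2 i) ∧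
      q.1.2 q.1.1 ∈ B ∧ ∃ i ≤ q.1.1, q.1.2 i ≠ e k i := by
    rintro k ⟨⟨n, f⟩, hf, hf0, hfG⟩
    obtain ⟨a, ha, hfa⟩ := exists_reflTransGen_of_mem_eventualPreimage (hbranch _ hfG)
    obtain ⟨n₁, f₁, hn₁, hf₁, hff₁, rfl⟩ := hf.exists_extend hfa
    have ha' := hG' _ _ hfa hfG
    -- Diagonal step: of two distinct successors, at least one differs from this term of the k-th
    -- listed sequence.
    obtain ⟨y, hy, hye⟩ : ∃ y ∈ S (f₁ n₁), y ≠ e k (n₁ + 1) :=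
      (one_lt_encard_iff_nontrivial.1 (lt_of_lt_of_le (by norm_num) ha)).exists_ne _
    obtain ⟨f₂, hf₂, hff₂, rfl⟩ := hf₁.exists_extend_one hy
    have hyG := hG _ ha' hy
    obtain ⟨b, hb, hyb⟩ := exists_reflTransGen_of_mem_eventualPreimage (hreach _ hyG)
    obtain ⟨n₃, f₃, hn₃, hf₃, hff₃, rfl⟩ := hf₂.exists_extend hyb
    have agree : ∀ i ≤ n, f₃ i = f i := fun i hi =>
      (hff₃ i (by omega)).trans ((hff₂ i (by omega)).trans (hff₁ i hi))
    refine ⟨⟨⟨n₃, f₃⟩, hf₃, (agree 0 (by omega)).trans hf0, hG' _ _ hyb hyG⟩, ?_, agree, hb,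
      n₁ + 1, hn₃, ?_⟩
    · change n < n₃
      omega
    · change f₃ (n₁ + 1) ≠ _
      rwa [hff₃ _ le_rfl]
  choose next hlt hagree hB hne using step
  let p : ℕ → T := fun k => Nat.rec ⟨⟨0, fun _ => x⟩, fun _ h => absurd h (by simp), rfl, hx⟩ next k
  have hp : ∀ k, p (k + 1) = next k (p k) := fun _ => rfl
  have hmono : StrictMono fun k => (p k).1.1 := strictMono_nat_of_lt_succ fun k => by
    simpa only [hp] using hlt k (p k)
  have hstable : ∀ j k, j ≤ k → ∀ i ≤ (p j).1.1, (p k).1.2 i = (p j).1.2 i := by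
    intro j k hjk
    induction k, hjk using Nat.le_induction with
    | base => exact fun _ _ => rfl
    | succ k hjk ih =>
      intro i hi
      rw [hp, hagree k (p k) i (hi.trans (hmono.monotone hjk)), ih i hi]
  -- The limit path: lengths increase strictly, so the i-th path has length at least i and its term
  -- i is final.
  let o : ℕ → X := fun i => (p i).1.2 i
  have ho : ∀ k, ∀ i ≤ (p k).1.1, o i = (p k).1.2 i := by
    intro k i hi
    rcases le_total i k with h | h
    · exact (hstable i k h i (hmono.le_apply)).symm
    · exact hstable k i h i hi
  have horb : IsOrbit S x o := by
    refine ⟨(p 0).2.2.1, fun n => ?_⟩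
    have hn : n + 1 ≤ (p (n + 1)).1.1 := hmono.le_apply
    rw [ho (n + 1) (n + 1) hn, ho (n + 1) n (by omega)]
    exact (p (n + 1)).2.1 n hn
  have hret : ReturnsInfinitelyOften o B := by
    refine infinite_of_not_bddAbove fun ⟨M, hM⟩ => ?_
    have hmem : o (p (M + 1)).1.1 ∈ B := by
      rw [ho (M + 1) _ le_rfl, hp]
      exact hB M (p M)
    have h₁ : (p (M + 1)).1.1 ≤ M := hM hmem
    have h₂ : M + 1 ≤ (p (M + 1)).1.1 := hmono.le_apply
    omega
  obtain ⟨k, hk⟩ := he ⟨horb, hret⟩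
  obtain ⟨i, hi, hne'⟩ := hne k (p k)
  apply hne'
  rw [hk, ho (k + 1) i (by rwa [hp]), hp]

theorem IsMTransformation.nonempty {m : ℕ} (hS : IsMTransformation m S) (x : X) : (S x).Nonempty :=
  one_le_encard_iff_nonempty.1 (hS x).1

theorem IsMTransformation.finite {m : ℕ} (hS : IsMTransformation m S) (x : X) : (S x).Finite :=
  finite_of_encard_le_coe (hS x).2

/-- Integrated, this turns invariance into μ(B) ≤ μ(S⁻¹(B)). -/
theorem kernel_le_indicator (S : X → Set X) (B : Set X) (x : X) :
    kernel S x B ≤ (fullPreimage S B).indicator 1 x := by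
  by_cases hx : x ∈ fullPreimage S B
  · rw [indicator_of_mem hx, kernel]
    refine (mul_le_mul_right (?_ : _ ≤ ((S x).encard : ℝ≥0∞)) _).trans (ENNReal.inv_mul_le_one _)
    calc ∑' y : S x, B.indicator 1 (y : X) ≤ ∑' _ : S x, (1 : ℝ≥0∞) :=
          ENNReal.tsum_le_tsum fun y => indicator_le_self' (fun _ _ => zero_le) _
      _ = ((S x).encard : ℝ≥0∞) := by
          rw [ENNReal.tsum_set_one]
  · have h0 : ∀ y : S x, B.indicator (1 : X → ℝ≥0∞) (y : X) = 0 := fun y =>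
      indicator_of_notMem (fun hy => hx ⟨y, y.2, hy⟩) _
    simp [kernel, h0]

end Combinatorics

section Measure

variable [MeasurableSpace X] {μ : Measure X} {m : ℕ} {S : X → Set X} {B : Set X}

theorem IsMeasurable.measurableSet_fullPreimage (hS : IsMeasurable m S) (hB : MeasurableSet B) :
    MeasurableSet (fullPreimage S B) := by
  have : fullPreimage S B = ⋃ (k : ℕ) (l : ℕ), preimageCard S k (l + 1) B := by
    ext x
    have hfin := hS.isMTransformation.finite x
    simp only [mem_iUnion]
    constructor
    · intro hx
      obtain ⟨l, hl⟩ : ∃ l, (S x ∩ B).ncard = l + 1 :=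
        Nat.exists_eq_succ_of_ne_zero ((ncard_pos (hfin.inter_of_left B)).2 hx).ne'
      refine ⟨(S x).ncard, l, hfin.cast_ncard_eq.symm, ?_⟩
      rw [← hl, (hfin.inter_of_left B).cast_ncard_eq]
    · rintro ⟨k, l, -, hl⟩
      refine one_le_encard_iff_nonempty.1 ?_
      rw [hl]
      exact_mod_cast Nat.succ_le_succ (Nat.zero_le l)
  rw [this]
  exact .iUnion fun k => .iUnion fun l => hS.measurableSet_preimageCard k (l + 1) B hB

theorem IsMeasurable.measurableSet_two_le_encard (hS : IsMeasurable m S) :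
    MeasurableSet {x | 2 ≤ (S x).encard} := by
  have : {x | 2 ≤ (S x).encard} = ⋃ k : ℕ, preimageCard S (k + 2) (k + 2) univ := by
    ext x
    have hfin := hS.isMTransformation.finite x
    simp only [mem_iUnion, preimageCard, inter_univ, mem_ofPred_eq, and_self]
    rw [← hfin.cast_ncard_eq]
    norm_cast
    exact ⟨fun h => ⟨_, (Nat.sub_add_cancel h).symm⟩, fun ⟨k, hk⟩ => by omega⟩
  rw [this]
  exact .iUnion fun k => hS.measurableSet_preimageCard (k + 2) (k + 2) univ .univ

theorem IsMeasurable.measurableSet_eventualPreimage (hS : IsMeasurable m S)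
    (hB : MeasurableSet B) : MeasurableSet (eventualPreimage S B) := by
  refine .iUnion fun n => ?_
  induction n with
  | zero => exact hB
  | succ n ih =>
    rw [Function.iterate_succ_apply']
    exact hS.measurableSet_fullPreimage ih

theorem IsNonsingular.eventualPreimage_null (hS : IsNonsingular m S μ) (hB : MeasurableSet B)
    (h0 : μ B = 0) : μ (eventualPreimage S B) = 0 := by
  refine measure_iUnion_null fun n => ?_
  suffices h : MeasurableSet ((fullPreimage S)^[n] B) ∧ μ ((fullPreimage S)^[n] B) = 0 from h.2
  induction n with
  | zero => exact ⟨hB, h0⟩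
  | succ n ih =>
    rw [Function.iterate_succ_apply']
    exact ⟨hS.isMeasurable.measurableSet_fullPreimage ih.1, hS.fullPreimage_null _ ih.1 ih.2⟩

/-- For an invariant measure, almost every point that can reach `B` has a successor that can. -/
theorem IsMeasurePreserving.measure_eventualPreimage_diff [IsFiniteMeasure μ]
    (hS : IsMeasurePreserving m S μ) (hB : MeasurableSet B) :
    μ (eventualPreimage S B \ fullPreimage S (eventualPreimage S B)) = 0 := by
  have hR := hS.isMeasurable.measurableSet_eventualPreimage hB
  have hP := hS.isMeasurable.measurableSet_fullPreimage hR
  have hle : μ (eventualPreimage S B) ≤ μ (fullPreimage S (eventualPreimage S B)) := by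
    rw [← hS.pushforward_eq _ hR, pushforward, ← lintegral_indicator_one hP]
    exact lintegral_mono fun x => kernel_le_indicator S _ x
  rw [measure_sdiff fullPreimage_eventualPreimage_subset hP.nullMeasurableSet
    (measure_ne_top _ _)]
  exact tsub_eq_zero_of_le hle

/-- Ergodicity needs exact inclusions, while R ⊆ S⁻¹(R) holds only up to the null set N. Hence all
points N' that can reach N are removed as well; N' is null by nonsingularity. -/
theorem IsErgodic.measure_compl_eventualPreimage [IsFiniteMeasure μ] (hE : IsErgodic m S μ)
    (hS : IsMeasurePreserving m S μ) (hB : MeasurableSet B) (hμB : 0 < μ B) :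
    μ (eventualPreimage S B)ᶜ = 0 := by
  set R := eventualPreimage S B with hRdef
  set N := R \ fullPreimage S R with hNdef
  set N' := eventualPreimage S N with hN'def
  have hR : MeasurableSet R := hS.isMeasurable.measurableSet_eventualPreimage hB
  have hN : MeasurableSet N := hR.diff (hS.isMeasurable.measurableSet_fullPreimage hR)
  have hN' : MeasurableSet N' := hS.isMeasurable.measurableSet_eventualPreimage hN
  have hN0 : μ N' = 0 :=
    hE.isNonsingular.eventualPreimage_null hN (hS.measure_eventualPreimage_diff hB)
  have hne := hS.isMeasurable.isMTransformation.nonempty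
  have hsub : (R \ N') \ fullPreimage S (R \ N') = ∅ := by
    rw [sdiff_eq_empty]
    rintro x ⟨hxR, hxN⟩
    by_cases hx : x ∈ fullPreimage S R
    · obtain ⟨y, hy, hyR⟩ := hx
      exact ⟨y, hy, hyR, fun hyN => hxN (fullPreimage_eventualPreimage_subset ⟨y, hy, hyN⟩)⟩
    · exact absurd (subset_eventualPreimage (show x ∈ N from ⟨hxR, hx⟩)) hxN
  have hsub' : (R \ N')ᶜ \ fullPreimage S (R \ N')ᶜ = ∅ := by
    rw [sdiff_eq_empty]
    intro x hx
    have escape : x ∉ fullPreimage S R → x ∈ fullPreimage S (R \ N')ᶜ := fun h => by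
      obtain ⟨y, hy⟩ := hne x
      exact ⟨y, hy, fun hyR => h ⟨y, hy, hyR.1⟩⟩
    by_cases hxR : x ∈ R
    · have hxN : x ∈ N' := by_contra fun h => hx ⟨hxR, h⟩
      rcases eventualPreimage_subset_union hxN with h | ⟨y, hy, hyN⟩
      -- A point of N has no successor in R; any other point of N' has a successor in N'.
      · exact escape h.2
      · exact ⟨y, hy, fun hyR => hyR.2 hyN⟩
    · exact escape fun h => hxR (fullPreimage_eventualPreimage_subset h)
  rcases hE.null_or_null_compl (R \ N') (hR.diff hN') hsub hsub' with h | h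
  · have hRle : μ R ≤ 0 := by
      calc μ R ≤ μ (R \ N' ∪ N') := measure_mono (by rw [sdiff_union_self]; exact subset_union_left)
        _ ≤ μ (R \ N') + μ N' := measure_union_le _ _
        _ = 0 := by rw [h, hN0, add_zero]
    exact absurd (hμB.trans_le (measure_mono subset_eventualPreimage)) (not_lt.2 hRle)
  · exact measure_mono_null (compl_subset_compl.2 sdiff_subset) h

end Measure

end MTransformation

open MTransformation in
theorem mainTheorem9 {X : Type*} [MeasurableSpace X] (μ : Measure X) [IsProbabilityMeasure μ]
    (m : ℕ) (S : X → Set X)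
    (hS : MTransformation.IsMeasurePreserving m S μ)
    (hE : MTransformation.IsErgodic m S μ)
    (hbranch : 0 < μ {x | 2 ≤ (S x).encard})
    (B : Set X) (hB : MeasurableSet B) (hμB : 0 < μ B) :
    ∀ᵐ x ∂μ, ¬ {o : ℕ → X | MTransformation.IsOrbit S x o ∧
      MTransformation.ReturnsInfinitelyOften o B}.Countable := by
  set A := {x | 2 ≤ (S x).encard} with hAdef
  have hA : MeasurableSet A := hS.isMeasurable.measurableSet_two_le_encard
  set C := eventualPreimage S A ∩ eventualPreimage S B with hCdef
  have hC : MeasurableSet C := (hS.isMeasurable.measurableSet_eventualPreimage hA).inter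
    (hS.isMeasurable.measurableSet_eventualPreimage hB)
  have hC0 : μ Cᶜ = 0 := by
    rw [hCdef, compl_inter]
    exact measure_union_null (hE.measure_compl_eventualPreimage hS hA hbranch)
      (hE.measure_compl_eventualPreimage hS hB hμB)
  have hG : ∀ x, x ∉ eventualPreimage S Cᶜ → x ∈ C := fun x hx =>
    by_contra fun h => hx (subset_eventualPreimage h)
  filter_upwards [measure_eq_zero_iff_ae_notMem.1
    (hE.isNonsingular.eventualPreimage_null hC.compl hC0)] with x hx
  -- The points that can never leave C form a forward closed subset of C.
  exact not_countable_orbits (G := (eventualPreimage S Cᶜ)ᶜ)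
    (fun y hy z hz hzC => hy (fullPreimage_eventualPreimage_subset ⟨z, hz, hzC⟩))
    (fun y hy => (hG y hy).1) (fun y hy => (hG y hy).2) hx
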